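/- In the vector scheduling problem with identical machines and makespan objective (VSMAX-I), jobs $0,1,\dots,n-1$ with load vectors $p_j\in\mathbb R_{\ge 0}^d$ arrive online one by one, and each job must be assigned, immediately and irrevocably, to one of $m\ge 1$ machines. The algorithm knows $m$ and $d$. An assignment $f$ has load $\Lambda_i(k)=\sum_{j:f(j)=i}p_j(k)$ on machine $i$ in dimension $k$, makespan norm $\|\Lambda(k)\|_\infty=\max_i\Lambda_i(k)$ in dimension $k$, and makespan $\max_k\|\Lambda(k)\|_\infty$. Let $\mathrm{OPT}_k$ be the minimum of $\|\Lambda(k)\|_\infty$ over all (offline) assignments. An online algorithm is an arbitrary function from the sequence of jobs seen so far to machines, with no bound on its computational resources; a randomized online algorithm is a random choice of such a function. Then there are absolute constants $c,C>0$ (with $\log$ the natural logarithm) with the following properties. (Lower bound) For every $d\ge 3$ there are $m\ge 1$ and $n$ such that for every randomized (in particular, for every deterministic) online algorithm for $m$ machines there is a sequence of $n$ jobs for which $\mathrm{OPT}_k=1$ for every dimension $k$, these optima are attained by a single assignment simultaneously, and the expected makespan of the algorithm is at least $c\,\frac{\log d}{\log\log d}$. Hence every online algorithm has competitive ratio $\Omega\left(\frac{\log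 d}{\log\log d}\right)$. (Upper bound) There is a deterministic online algorithm that is $C\,\frac{\log d}{\log\log d}$-competitive for every $d\ge 3$ and every $m\ge 1$: on every sequence of jobs, $\|\Lambda(k)\|_\infty\le C\,\frac{\log d}{\log\log d}\cdot\max_{k'}\mathrm{OPT}_{k'}$ for every dimension $k$. In particular its makespan is at most $C\,\frac{\log d}{\log\log d}$ times the optimal makespan. -/

import Mathlib

universe u

open MeasureTheory
open scoped NNReal

noncomputable section

namespace VectorScheduling

/-- The load vector of a job in `d` dimensions. On identical machines it does not depend on the
machine to which the job is assigned. -/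
abbrev Job (d : ℕ) : Type := Fin d → ℝ≥0

/-- The load `Λ_i(k)` of machine `i` in dimension `k` when the jobs `p` are assigned to the `m`
machines by `f`. -/
def load {n d m : ℕ} (p : Fin n → Job d) (f : Fin n → Fin m) (i : Fin m) (k : Fin d) : ℝ≥0 :=
  ∑ j with f j = i, p j k

/-- The makespan norm `‖Λ(k)‖_∞ = max_i Λ_i(k)` in dimension `k` of the assignment `f`. -/
def makespanNorm {n d m : ℕ} (p : Fin n → Job d) (f : Fin n → Fin m) (k : Fin d) : ℝ≥0 :=
  Finset.univ.sup fun i => load p f i k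

/-- The makespan: the largest load over all machines and all dimensions. -/
def makespan {n d m : ℕ} (p : Fin n → Job d) (f : Fin n → Fin m) : ℝ≥0 :=
  Finset.univ.sup fun k => makespanNorm p f k

/-- The optimal (offline) makespan norm in dimension `k` on `m` machines. -/
def optNorm {n d : ℕ} (m : ℕ) (p : Fin n → Job d) (k : Fin d) : ℝ≥0 :=
  ⨅ f : Fin n → Fin m, makespanNorm p f k

/-- The optimal (offline) makespan on `m` machines. -/
def opt {n d : ℕ} (m : ℕ) (p : Fin n → Job d) : ℝ≥0 :=
  ⨅ f : Fin n → Fin m, makespan p f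

/-- The instance is scaled so that the optimal makespan norm in each dimension is `1`, and a single
assignment attains these optima in all dimensions at once. -/
def IsNormalized {n d : ℕ} (m : ℕ) (p : Fin n → Job d) : Prop :=
  (∀ k, optNorm m p k = 1) ∧ ∃ g : Fin n → Fin m, ∀ k, makespanNorm p g k = 1

/-- A deterministic online algorithm for `m` machines and `d` dimensions: given the list of all jobs
that have arrived so far, in order of arrival and ending in the current job, it names the machine
to which the current job is assigned. -/
structure OnlineAlgorithm (d m : ℕ) where
  choose : List (Job d) → Fin m

/-- The assignment that the online algorithm produces: job `j` is assigned on the basis of the jobs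
`0, …, j` only. -/
def OnlineAlgorithm.run {n d m : ℕ} (A : OnlineAlgorithm d m) (p : Fin n → Job d) :
    Fin n → Fin m :=
  fun j => A.choose ((List.ofFn p).take (j + 1))

/-- `A` is `α`-competitive: on every instance, and for every `L` such that the optimal makespan norm
is at most `L` in each dimension, the algorithm has makespan norm at most `α * L` in each dimension.
The algorithm is not told `L`. The case `L = 1` is the definition for instances that are scaled to
have optimum `1` in each dimension; `L = opt m p` gives `makespan ≤ α * opt`. -/
def OnlineAlgorithm.IsCompetitive {d m : ℕ} (A : OnlineAlgorithm d m) (α : ℝ) : Prop :=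
  ∀ (n : ℕ) (p : Fin n → Job d) (L : ℝ≥0), (∀ k, optNorm m p k ≤ L) →
    ∀ k, (makespanNorm p (A.run p) k : ℝ) ≤ α * L

/-- A randomized online algorithm: a random deterministic one. -/
structure RandomizedOnlineAlgorithm (d m : ℕ) where
  Ω : Type u
  [measurableSpace : MeasurableSpace Ω]
  μ : Measure Ω
  [isProbabilityMeasure : IsProbabilityMeasure μ]
  alg : Ω → OnlineAlgorithm d m
  measurable_choose : ∀ h : List (Job d), Measurable fun ω => (alg ω).choose h

attribute [instance] RandomizedOnlineAlgorithm.measurableSpace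
attribute [instance] RandomizedOnlineAlgorithm.isProbabilityMeasure

/-- The expected makespan of a randomized online algorithm on a fixed instance. -/
def RandomizedOnlineAlgorithm.expectedMakespan {n d m : ℕ}
    (R : RandomizedOnlineAlgorithm.{u} d m) (p : Fin n → Job d) : ℝ :=
  ∫ ω, (makespan p ((R.alg ω).run p) : ℝ) ∂(R.μ)

/-- A competitive algorithm has makespan at most `α` times the optimal makespan. -/
theorem OnlineAlgorithm.IsCompetitive.makespan_le {n d m : ℕ} {A : OnlineAlgorithm d m} {α : ℝ}
    (hA : A.IsCompetitive α) (hα : 0 ≤ α) (p : Fin n → Job d) :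
    (makespan p (A.run p) : ℝ) ≤ α * opt m p := by
  have hL : ∀ k, optNorm m p k ≤ opt m p := fun k =>
    haveI : Nonempty (Fin n → Fin m) := ⟨A.run p⟩
    ciInf_mono (OrderBot.bddBelow _) fun f =>
      Finset.le_sup (f := fun k => makespanNorm p f k) (Finset.mem_univ k)
  have h : makespan p (A.run p) ≤ ⟨α, hα⟩ * opt m p :=
    Finset.sup_le fun k _ => by exact_mod_cast hA n p _ hL k
  exact_mod_cast h

end VectorScheduling

end

/-!
The competitive ratio of vector scheduling on identical machines is of order
`log d / log (log d)`.

*Upper bound.* Suppose first that a bound `ℓ` on the optimum is known. Then every job is at most `ℓ`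
and the total load per machine is at most `ℓ` in each dimension. A uniformly random assignment would
give load above `α * ℓ`, where `α` is of order `log d / log (log d)`, to a machine with
probability less than a negative power of `d`. It is derandomised by the potential
`∑ k, ∑ i, a ^ (U i k / ℓ) * exp (-(a - 1) * (∑ i', U i' k) / (m * ℓ))`: some machine does not
increase it (`exists_potential_addAt_le`). The number of machines is not bounded in terms of `d`, so
the potential does not prevent overloaded machines altogether, but it makes their total load at most
`m * ℓ` (`sum_overloaded_le`). Jobs that would overload their machine are therefore spilled: they go
to the machine that got the least from spilled jobs, which adds at most `2 * ℓ`. When a lower bound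
`M` on the optimum exceeds the guess `ℓ`, a new phase starts with guess `2 * M`; since the guesses
grow geometrically, the loads of earlier phases are absorbed (`PhaseState.Inv`,
`phaseAlgorithm_isCompetitive`).

*Lower bound.* The jobs are the vertices of a graph, the machines are `t = 8 * s ^ 2` colours, and
each dimension tests a set of at most `s` vertices: a vertex of the set has load `1` as long as the
set restricted to the vertices so far is a clique. Each vertex `v` has a pair `x v` of colours, the
first being its hidden colour, and an earlier vertex `w` is adjacent to `v` if the colour of `w` is
not in the pair of `v`. The hidden colours form a proper colouring, so that they give an assignment
of makespan `1` in all dimensions. The algorithm sees the pair without its order. A random pair has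
with probability at least `1/2` no bin in which both colours occur, and then the hidden colour is new
in the chosen bin with probability at least `1/2` (`sq_le_four_mul_card_new`). Keeping only the
vertices whose colour is new, each vertex misses at most one earlier vertex of its bin, so that the
bin splits into two cliques (`kept_spec`). After `128 * s ^ 3` vertices some bin contains a clique of size `s`
with probability at least `1/2`; the adversary derandomises the choice of the pairs against the given
algorithm (`exists_adversary`). Finally `(128 * s ^ 3) ^ s ≤ d` permits `s` of order
`log d / log (log d)`.
-/

noncomputable section

namespace VectorScheduling

/-! ### Derandomising the uniform assignment -/

/-- The loads `u` after a job with load vector `q` has been put on machine `v`. -/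
def addAt {R : Type*} [AddZeroClass R] {d m : ℕ} (u : Fin m → Fin d → R) (v : Fin m)
    (q : Fin d → R) : Fin m → Fin d → R :=
  fun i k => u i k + if i = v then q k else 0

theorem sum_addAt {R : Type*} [AddCommMonoid R] {d m : ℕ} (u : Fin m → Fin d → R) (v : Fin m)
    (q : Fin d → R) (k : Fin d) : ∑ i, addAt u v q i k = ∑ i, u i k + q k := by
  simp [addAt, Finset.sum_add_distrib]

/-- The exponential potential of the loads `u`. The second factor compensates the growth that the
first one is expected to show when the same total load is assigned uniformly at random. -/
def potential {d m : ℕ} (a : ℝ) (u : Fin m → Fin d → ℝ) : ℝ :=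
  ∑ k, ∑ i, a ^ u i k * Real.exp (-((a - 1) * (∑ i', u i' k) / m))

/-- Under a uniformly random choice of the machine the potential does not increase in expectation,
hence some machine does not increase it. -/
theorem exists_potential_addAt_le {d m : ℕ} (hm : 0 < m) {a : ℝ} (ha : 1 < a)
    (u : Fin m → Fin d → ℝ) (q : Fin d → ℝ) (hq0 : ∀ k, 0 ≤ q k) (hq1 : ∀ k, q k ≤ 1) :
    ∃ v, potential a (addAt u v q) ≤ potential a u := by
  have : Nonempty (Fin m) := ⟨⟨0, hm⟩⟩
  have hm' : (0 : ℝ) < m := by exact_mod_cast hm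
  have ha0 : 0 < a := by linarith
  suffices h : ∑ v, potential a (addAt u v q) ≤ ∑ _v : Fin m, potential a u by
    obtain ⟨v, -, hv⟩ := Finset.exists_le_of_sum_le Finset.univ_nonempty h
    exact ⟨v, hv⟩
  rw [Finset.sum_const, Finset.card_univ, Fintype.card_fin, nsmul_eq_mul]
  simp only [potential, sum_addAt, Finset.mul_sum (a := (m : ℝ))]
  rw [Finset.sum_comm]
  refine Finset.sum_le_sum fun k _ => ?_
  rw [Finset.sum_comm]
  refine Finset.sum_le_sum fun i _ => ?_
  rw [← Finset.sum_mul]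
  have h1 : ∑ v, a ^ addAt u v q i k = a ^ u i k * (m + (a ^ q k - 1)) := by
    have : ∀ v, a ^ addAt u v q i k
        = a ^ u i k + if i = v then a ^ u i k * (a ^ q k - 1) else 0 := by
      intro v
      unfold addAt
      split_ifs
      · rw [Real.rpow_add ha0]; ring
      · simp
    simp only [this, Finset.sum_add_distrib, Finset.sum_ite_eq, Finset.mem_univ, if_true,
      Finset.sum_const, Finset.card_univ, Fintype.card_fin, nsmul_eq_mul]
    ring
  have h2 : a ^ q k ≤ 1 + q k * (a - 1) := by
    have := rpow_one_add_le_one_add_mul_self (s := a - 1) (by linarith) (hq0 k) (hq1 k)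
    simpa using this
  have h3 : (m : ℝ) + (a ^ q k - 1) ≤ m * Real.exp ((a - 1) * q k / m) := by
    have := Real.add_one_le_exp ((a - 1) * q k / m)
    calc (m : ℝ) + (a ^ q k - 1) ≤ m * ((a - 1) * q k / m + 1) := by
          field_simp; linarith
      _ ≤ _ := by gcongr
  have h4 : Real.exp (-((a - 1) * (∑ i', u i' k + q k) / m))
      = Real.exp (-((a - 1) * (∑ i', u i' k) / m)) * Real.exp (-((a - 1) * q k / m)) := by
    rw [← Real.exp_add]; congr 1; ring
  have h5 : Real.exp ((a - 1) * q k / m) * Real.exp (-((a - 1) * q k / m)) = 1 := by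
    rw [← Real.exp_add]; simp
  rw [h1, h4]
  have h6 : 0 ≤ a ^ u i k := (Real.rpow_pos_of_pos ha0 _).le
  calc a ^ u i k * (m + (a ^ q k - 1)) * (Real.exp (-((a - 1) * (∑ i', u i' k) / m)) *
        Real.exp (-((a - 1) * q k / m)))
      ≤ a ^ u i k * (m * Real.exp ((a - 1) * q k / m)) *
        (Real.exp (-((a - 1) * (∑ i', u i' k) / m)) * Real.exp (-((a - 1) * q k / m))) := by
        gcongr
    _ = m * (a ^ u i k * Real.exp (-((a - 1) * (∑ i', u i' k) / m))) *
        (Real.exp ((a - 1) * q k / m) * Real.exp (-((a - 1) * q k / m))) := by ring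
    _ = _ := by rw [h5, mul_one]

/-- If the potential has not grown beyond its initial value `m * d`, then the machines on which some
dimension is overloaded carry little load altogether. -/
theorem sum_overloaded_le {d m : ℕ} (hm : 0 < m) {a α : ℝ} (ha : Real.exp 1 ≤ a)
    (hα : d * d * Real.exp (a - 1) ≤ (a / Real.exp 1) ^ α)
    (u : Fin m → Fin d → ℝ) (hvol : ∀ k, ∑ i, u i k ≤ m)
    (hpot : potential a u ≤ m * d) :
    ∑ i, (open Classical in if ∃ k, α < u i k then ∑ k, u i k else 0) ≤ m := by
  classical
  have hm' : (0 : ℝ) < m := by exact_mod_cast hm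
  have he : (0 : ℝ) < Real.exp 1 := Real.exp_pos 1
  have he1 : (1 : ℝ) ≤ Real.exp 1 := Real.one_le_exp (by norm_num)
  have ha0 : 0 < a := by linarith
  set B : ℝ := (a / Real.exp 1) ^ α with hB
  have hB0 : 0 < B := Real.rpow_pos_of_pos (by positivity) _
  have hmachine : ∀ i, (if ∃ k, α < u i k then ∑ k, u i k else 0) ≤
      d / B * ∑ k, a ^ u i k := by
    intro i
    have hnn : 0 ≤ ∑ k, a ^ u i k := Finset.sum_nonneg fun k _ => (Real.rpow_pos_of_pos ha0 _).le
    split_ifs with h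
    · obtain ⟨k₀, hk₀⟩ := h
      obtain ⟨k₁, -, hk₁⟩ := Finset.exists_max_image Finset.univ (u i) ⟨k₀, Finset.mem_univ _⟩
      have h1 : ∑ k, u i k ≤ d * u i k₁ := by
        have := Finset.sum_le_card_nsmul Finset.univ (u i) (u i k₁) fun k hk => hk₁ k hk
        simpa using this
      have hαk : α ≤ u i k₁ := hk₀.le.trans (hk₁ k₀ (Finset.mem_univ _))
      have h2 : u i k₁ * B ≤ a ^ u i k₁ := by
        have h3 : u i k₁ ≤ Real.exp 1 ^ u i k₁ := by
          rw [← Real.exp_mul, one_mul]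
          linarith [Real.add_one_le_exp (u i k₁)]
        have h4 : B ≤ (a / Real.exp 1) ^ u i k₁ :=
          Real.rpow_le_rpow_of_exponent_le ((one_le_div he).2 ha) hαk
        calc u i k₁ * B ≤ Real.exp 1 ^ u i k₁ * (a / Real.exp 1) ^ u i k₁ :=
              mul_le_mul h3 h4 hB0.le (Real.rpow_nonneg he.le _)
          _ = a ^ u i k₁ := by
              rw [← Real.mul_rpow he.le (by positivity), mul_div_cancel₀ _ he.ne']
      have h5 : a ^ u i k₁ ≤ ∑ k, a ^ u i k :=
        Finset.single_le_sum (f := fun k => a ^ u i k)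
          (fun k _ => (Real.rpow_pos_of_pos ha0 _).le) (Finset.mem_univ k₁)
      rw [div_mul_eq_mul_div, le_div_iff₀ hB0]
      calc (∑ k, u i k) * B ≤ d * u i k₁ * B := by gcongr
        _ = d * (u i k₁ * B) := by ring
        _ ≤ _ := by gcongr; exact h2.trans h5
    · positivity
  have hpot' : Real.exp (-(a - 1)) * ∑ k, ∑ i, a ^ u i k ≤ m * d := by
    refine le_trans ?_ hpot
    rw [potential, Finset.mul_sum]
    refine Finset.sum_le_sum fun k _ => ?_
    rw [Finset.mul_sum]
    refine Finset.sum_le_sum fun i _ => ?_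
    rw [mul_comm]
    refine mul_le_mul_of_nonneg_left (Real.exp_le_exp.2 ?_) (Real.rpow_pos_of_pos ha0 _).le
    rw [neg_le_neg_iff, div_le_iff₀ hm']
    exact mul_le_mul_of_nonneg_left (hvol k) (by linarith)
  have hsum : ∑ k, ∑ i, a ^ u i k ≤ m * d * Real.exp (a - 1) := by
    have h := mul_le_mul_of_nonneg_right hpot' (Real.exp_pos (a - 1)).le
    rwa [mul_right_comm, ← Real.exp_add, neg_add_cancel, Real.exp_zero, one_mul] at h
  calc _ ≤ ∑ i, d / B * ∑ k, a ^ u i k := Finset.sum_le_sum fun i _ => hmachine i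
    _ = d / B * ∑ k, ∑ i, a ^ u i k := by rw [← Finset.mul_sum, Finset.sum_comm]
    _ ≤ d / B * (m * d * Real.exp (a - 1)) := by gcongr
    _ = m * (d * d * Real.exp (a - 1)) / B := by ring
    _ ≤ m * B / B := by gcongr
    _ = m := by field_simp

/-! ### The online algorithm -/

/-- The memory of the online algorithm. -/
structure PhaseState (d m : ℕ) where
  /-- the current guess of the optimum -/
  scale : ℝ≥0
  /-- the virtual loads in the current phase: every job counts on the machine that the potential
  suggests, even if it has been put elsewhere -/
  virt : Fin m → Fin d → ℝ≥0
  /-- the total of `max_k p k` over the spilled jobs `p` that each machine got in the current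
  phase -/
  spill : Fin m → ℝ≥0

namespace PhaseState

variable {d m : ℕ}

/-- A lower bound on the optimum that is implied by the jobs of the phase, including the current
job `p`. -/
def lowerBound (U : Fin m → Fin d → ℝ≥0) (p : Job d) : ℝ≥0 :=
  Finset.univ.sup fun k => max (p k) ((∑ i, U i k + p k) / m)

theorem le_lowerBound (U : Fin m → Fin d → ℝ≥0) (p : Job d) (k : Fin d) :
    max (p k) ((∑ i, U i k + p k) / m) ≤ lowerBound U p :=
  Finset.le_sup (f := fun k => max (p k) ((∑ i, U i k + p k) / m)) (Finset.mem_univ k)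

/-- A new phase starts when the guess has been refuted. -/
def rescale (s : PhaseState d m) (p : Job d) : PhaseState d m :=
  if lowerBound s.virt p ≤ s.scale then s else ⟨2 * lowerBound s.virt p, 0, 0⟩

/-- The virtual loads `U` in units of `ℓ` (and `0` if `ℓ = 0`). -/
def relative (ℓ : ℝ≥0) (U : Fin m → Fin d → ℝ≥0) : Fin m → Fin d → ℝ :=
  fun i k => (U i k : ℝ) / ℓ

open Classical in
/-- The load that the virtual assignment puts on overloaded machines, in all dimensions together. -/
def overload (α : ℝ≥0) (ℓ : ℝ≥0) (U : Fin m → Fin d → ℝ≥0) : ℝ≥0 :=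
  ∑ i, if ∃ k, α * ℓ < U i k then ∑ k, U i k else 0

/-- The invariant that relates the state to the loads `x` of the jobs assigned so far. The first
term in `load_le` accounts for the earlier phases. -/
structure Inv (a : ℝ) (α : ℝ≥0) (s : PhaseState d m) (x : Fin m → Fin d → ℝ≥0) : Prop where
  vol : ∀ k, ∑ i, s.virt i k ≤ m * s.scale
  pot : potential a (relative s.scale s.virt) ≤ m * d
  spill_sum : ∑ i, s.spill i ≤ overload α s.scale s.virt
  spill_le : ∀ i, s.spill i ≤ 2 * s.scale
  load_le : ∀ i k, x i k ≤ (α + 2) * s.scale + min (s.virt i k) (α * s.scale) + s.spill i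

theorem potential_zero {a : ℝ} : potential a (0 : Fin m → Fin d → ℝ) = m * d := by
  simp [potential, mul_comm]

theorem relative_zero {ℓ : ℝ≥0} : relative ℓ (0 : Fin m → Fin d → ℝ≥0) = 0 := by
  ext; simp [relative]

theorem inv_zero {a : ℝ} {α ℓ : ℝ≥0} {x : Fin m → Fin d → ℝ≥0}
    (hx : ∀ i k, x i k ≤ (α + 2) * ℓ) : Inv a α (⟨ℓ, 0, 0⟩ : PhaseState d m) x where
  vol k := by simp
  pot := by simp [relative_zero, potential_zero]
  spill_sum := by simp
  spill_le i := by simp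
  load_le i k := by simpa using hx i k

theorem Inv.load_le_scale {a : ℝ} {α : ℝ≥0} {s : PhaseState d m} {x : Fin m → Fin d → ℝ≥0}
    (h : Inv a α s x) (i : Fin m) (k : Fin d) : x i k ≤ 2 * (α + 2) * s.scale :=
  calc x i k ≤ (α + 2) * s.scale + α * s.scale + 2 * s.scale :=
        (h.load_le i k).trans (by gcongr; exacts [min_le_right _ _, h.spill_le i])
    _ = _ := by ring

/-- At the start of a new phase the guess at least doubles, so that the whole load so far is
absorbed by the allowance for the earlier phases. -/
theorem Inv.rescale {a : ℝ} {α : ℝ≥0} {s : PhaseState d m} {x : Fin m → Fin d → ℝ≥0}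
    (h : Inv a α s x) (p : Job d) : Inv a α (s.rescale p) x := by
  unfold PhaseState.rescale
  split_ifs with hM
  · exact h
  · refine inv_zero fun i k => (h.load_le_scale i k).trans ?_
    rw [mul_comm 2, mul_assoc]
    gcongr
    exact (not_le.1 hM).le

theorem lowerBound_rescale_le (s : PhaseState d m) (p : Job d) :
    lowerBound (s.rescale p).virt p ≤ (s.rescale p).scale := by
  unfold PhaseState.rescale
  split_ifs with hM
  · exact hM
  · refine le_trans (Finset.sup_mono_fun fun k _ => ?_)
      (le_mul_of_one_le_left (zero_le) one_le_two)
    gcongr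
    simp

/-- A spilled job is paid for by the growth of the overload on its virtual machine. -/
theorem overload_addAt {α ℓ : ℝ≥0} (U : Fin m → Fin d → ℝ≥0) (v : Fin m) (p : Job d) (y : ℝ≥0)
    (hy : y = 0 ∨ y ≤ ∑ k, p k ∧ ∃ k, α * ℓ < addAt U v p v k) :
    overload α ℓ U + y ≤ overload α ℓ (addAt U v p) := by
  classical
  have hle : ∀ i k, U i k ≤ addAt U v p i k := fun i k => le_self_add
  have : overload α ℓ U + y
      = ∑ i, ((if ∃ k, α * ℓ < U i k then ∑ k, U i k else 0) + if i = v then y else 0) := by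
    simp [overload, Finset.sum_add_distrib]
  rw [this, overload]
  refine Finset.sum_le_sum fun i _ => ?_
  by_cases hi : ∃ k, α * ℓ < addAt U v p i k
  · rw [if_pos hi]
    have h1 : ∑ k, addAt U v p i k = ∑ k, U i k + if i = v then ∑ k, p k else 0 := by
      simp only [addAt, Finset.sum_add_distrib]
      split_ifs <;> simp
    rw [h1]
    gcongr
    · split_ifs
      · exact le_rfl
      · exact zero_le
    · split_ifs
      · rcases hy with rfl | hy
        · exact zero_le
        · exact hy.1
      · exact le_rfl
  · have h1 : ¬ ∃ k, α * ℓ < U i k := fun ⟨k, hk⟩ => hi ⟨k, hk.trans_le (hle i k)⟩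
    rw [if_neg hi, if_neg h1, zero_add]
    split_ifs with h2
    · subst h2
      rcases hy with rfl | hy
      · exact le_rfl
      · exact absurd hy.2 hi
    · exact le_rfl

/-- Since the potential keeps the overload small, the spilled jobs would fit on the machines if they
were spread evenly. -/
theorem Inv.spill_sum_le [Nonempty (Fin m)] {a : ℝ} {α : ℝ≥0} (ha : Real.exp 1 ≤ a)
    (hα : d * d * Real.exp (a - 1) ≤ (a / Real.exp 1) ^ (α : ℝ))
    {s : PhaseState d m} {x : Fin m → Fin d → ℝ≥0} (h : Inv a α s x) :
    ∑ i, s.spill i ≤ m * s.scale := by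
  classical
  refine h.spill_sum.trans ?_
  have hm : 0 < m := Fin.pos_iff_nonempty.2 ‹_›
  rcases eq_or_ne s.scale 0 with h0 | h0
  · have hU : ∀ i k, s.virt i k = 0 := fun i k => by
      have := h.vol k
      rw [h0, mul_zero] at this
      exact (Finset.sum_eq_zero_iff.1 (le_antisymm this (zero_le))) i (Finset.mem_univ _)
    simp [overload, hU]
  · have hs : (0 : ℝ) < s.scale := by positivity
    have := sum_overloaded_le hm ha hα (relative s.scale s.virt) (fun k => by
      simp only [relative]
      rw [← Finset.sum_div, div_le_iff₀ hs]
      exact_mod_cast h.vol k) h.pot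
    rw [← NNReal.coe_le_coe]
    simp only [overload]
    push_cast
    rw [← div_le_iff₀ hs, Finset.sum_div]
    refine le_trans (le_of_eq (Finset.sum_congr rfl fun i _ => ?_)) this
    have hiff : (∃ k, α * s.scale < s.virt i k) ↔ ∃ k, (α : ℝ) < relative s.scale s.virt i k := by
      refine exists_congr fun k => ?_
      rw [relative, lt_div_iff₀ hs]
      exact_mod_cast Iff.rfl
    rw [if_congr hiff rfl rfl]
    split_ifs
    · push_cast
      simp only [relative]
      rw [Finset.sum_div]
    · simp

variable [Nonempty (Fin m)]

/-- A machine on which the job does not increase the potential. -/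
def virtTarget (a : ℝ) (s : PhaseState d m) (p : Job d) : Fin m :=
  Classical.epsilon fun v => potential a (relative s.scale (addAt s.virt v p)) ≤
    potential a (relative s.scale s.virt)

/-- A machine that got the least from spilled jobs. -/
def spillTarget (s : PhaseState d m) : Fin m :=
  Classical.epsilon fun g => ∀ i, s.spill g ≤ s.spill i

open Classical in
/-- Assignment of the job `p`: it goes to its virtual machine unless this is overloaded by it, and
is spilled otherwise. The result is the machine and the new state. -/
def place (a : ℝ) (α : ℝ≥0) (s : PhaseState d m) (p : Job d) : Fin m × PhaseState d m :=
  let U := addAt s.virt (s.virtTarget a p) p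
  if ∀ k, U (s.virtTarget a p) k ≤ α * s.scale then
    (s.virtTarget a p, ⟨s.scale, U, s.spill⟩)
  else
    (s.spillTarget, ⟨s.scale, U,
      fun i => s.spill i + if i = s.spillTarget then Finset.univ.sup p else 0⟩)

theorem potential_virtTarget_le {a : ℝ} (ha : 1 < a) (s : PhaseState d m) (p : Job d)
    (hp : ∀ k, p k ≤ s.scale) :
    potential a (relative s.scale (addAt s.virt (s.virtTarget a p) p)) ≤
      potential a (relative s.scale s.virt) := by
  have hm : 0 < m := Fin.pos_iff_nonempty.2 ‹_›
  refine Classical.epsilon_spec (p := fun v =>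
    potential a (relative s.scale (addAt s.virt v p)) ≤ potential a (relative s.scale s.virt)) ?_
  obtain ⟨v, hv⟩ := exists_potential_addAt_le hm ha (relative s.scale s.virt)
    (fun k => (p k : ℝ) / s.scale) (fun k => by positivity)
    (fun k => div_le_one_of_le₀ (by exact_mod_cast hp k) (by positivity))
  refine ⟨v, le_trans (le_of_eq ?_) hv⟩
  congr 1
  ext i k
  simp only [relative, addAt]
  split_ifs <;> simp [add_div]

theorem spillTarget_le (s : PhaseState d m) (i : Fin m) : s.spill s.spillTarget ≤ s.spill i := by
  have : ∃ g, ∀ i, s.spill g ≤ s.spill i := Finite.exists_min s.spill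
  exact Classical.epsilon_spec this i

theorem place_snd_virt (a : ℝ) (α : ℝ≥0) (s : PhaseState d m) (p : Job d) :
    (place a α s p).2.virt = addAt s.virt (s.virtTarget a p) p := by
  unfold place; dsimp only; split_ifs <;> rfl

theorem place_snd_scale (a : ℝ) (α : ℝ≥0) (s : PhaseState d m) (p : Job d) :
    (place a α s p).2.scale = s.scale := by
  unfold place; dsimp only; split_ifs <;> rfl

theorem Inv.place {a : ℝ} {α : ℝ≥0} (ha : Real.exp 1 ≤ a)
    (hα : d * d * Real.exp (a - 1) ≤ (a / Real.exp 1) ^ (α : ℝ))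
    {s : PhaseState d m} {x : Fin m → Fin d → ℝ≥0} (h : Inv a α s x) (p : Job d)
    (hM : lowerBound s.virt p ≤ s.scale) :
    Inv a α (place a α s p).2 (addAt x (place a α s p).1 p) := by
  have hm : 0 < m := Fin.pos_iff_nonempty.2 ‹_›
  have ha1 : 1 < a := (Real.one_lt_exp_iff.2 one_pos).trans_le ha
  have hp : ∀ k, p k ≤ s.scale := fun k =>
    (le_max_left _ _).trans ((le_lowerBound s.virt p k).trans hM)
  set v := s.virtTarget a p with hv
  have hvol : ∀ k, ∑ i, addAt s.virt v p i k ≤ m * s.scale := fun k => by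
    have := (le_max_right _ _).trans ((le_lowerBound s.virt p k).trans hM)
    rwa [div_le_iff₀ (by exact_mod_cast hm), mul_comm, ← sum_addAt s.virt v] at this
  have hpot : potential a (relative s.scale (addAt s.virt v p)) ≤ m * d :=
    (potential_virtTarget_le ha1 s p hp).trans h.pot
  have hle : ∀ i k, s.virt i k ≤ addAt s.virt v p i k := fun i k => le_self_add
  by_cases hfit : ∀ k, addAt s.virt v p v k ≤ α * s.scale
  · have : PhaseState.place a α s p = (v, ⟨s.scale, addAt s.virt v p, s.spill⟩) := by
      unfold PhaseState.place; dsimp only; rw [← hv, if_pos hfit]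
    rw [this]
    refine ⟨hvol, hpot, h.spill_sum.trans ?_, h.spill_le, fun i k => ?_⟩
    · simpa using overload_addAt (α := α) (ℓ := s.scale) s.virt v p 0 (Or.inl rfl)
    · have hx := h.load_le i k
      dsimp only
      by_cases hi : i = v
      · rw [hi] at hx ⊢
        have h1 := hfit k
        rw [min_eq_left h1]
        rw [min_eq_left ((hle _ k).trans h1)] at hx
        simp only [addAt, if_true]
        exact (add_le_add_left hx _).trans_eq (by ring)
      · simpa [addAt, hi] using hx
  · have : PhaseState.place a α s p = (s.spillTarget, ⟨s.scale, addAt s.virt v p,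
        fun i => s.spill i + if i = s.spillTarget then Finset.univ.sup p else 0⟩) := by
      unfold PhaseState.place; dsimp only; rw [← hv, if_neg hfit]
    rw [this]
    push Not at hfit
    have hsup : Finset.univ.sup p ≤ ∑ k, p k :=
      Finset.sup_le fun k _ => Finset.single_le_sum (fun _ _ => zero_le) (Finset.mem_univ k)
    refine ⟨hvol, hpot, ?_, fun i => ?_, fun i k => ?_⟩
    · simp only [Finset.sum_add_distrib, Finset.sum_ite_eq', Finset.mem_univ, if_true]
      exact (add_le_add_left h.spill_sum _).trans
        (overload_addAt s.virt v p _ (Or.inr ⟨hsup, hfit⟩))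
    · dsimp only
      split_ifs with hi
      · subst hi
        -- the least spill load is at most the average
        have h1 : m * s.spill s.spillTarget ≤ m * s.scale := by
          refine le_trans ?_ (h.spill_sum_le ha hα)
          have := Finset.card_nsmul_le_sum Finset.univ s.spill (s.spill s.spillTarget)
            fun i _ => s.spillTarget_le i
          simpa using this
        have h2 := le_of_mul_le_mul_left h1 (by exact_mod_cast hm)
        rw [two_mul]
        exact add_le_add h2 (Finset.sup_le fun k _ => hp k)
      · simpa using h.spill_le i
    · have hx := h.load_le i k
      dsimp only
      simp only [addAt]
      calc x i k + (if i = s.spillTarget then p k else 0)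
          ≤ ((α + 2) * s.scale + min (s.virt i k) (α * s.scale) + s.spill i) +
            (if i = s.spillTarget then Finset.univ.sup p else 0) := by
            gcongr
            split_ifs
            · exact Finset.le_sup (f := p) (Finset.mem_univ k)
            · exact le_rfl
        _ ≤ _ := by
            rw [add_assoc _ (s.spill i)]
            gcongr
            exact hle i k

/-- The state after the jobs in the list `l`. -/
def after (a : ℝ) (α : ℝ≥0) (l : List (Job d)) : PhaseState d m :=
  l.foldl (fun s p => (place a α (s.rescale p) p).2) ⟨0, 0, 0⟩

end PhaseState

open PhaseState

/-- The online algorithm with base `a` of the potential and threshold `α` for overloading. -/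
def phaseAlgorithm (d m : ℕ) [Nonempty (Fin m)] (a : ℝ) (α : ℝ≥0) : OnlineAlgorithm d m where
  choose h :=
    match h.getLast? with
    | none => Classical.arbitrary _
    | some p => (place a α ((after a α h.dropLast).rescale p) p).1

/-- A bound `L` on the optimal makespan norm in dimension `k` bounds each job and the average
machine load. -/
theorem le_and_sum_le_of_optNorm_le {n d m : ℕ} [Nonempty (Fin m)] {p : Fin n → Job d} {k : Fin d}
    {L : ℝ≥0} (h : optNorm m p k ≤ L) : (∀ j, p j k ≤ L) ∧ ∑ j, p j k ≤ m * L := by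
  obtain ⟨f, hf⟩ := exists_eq_ciInf_of_finite (f := fun f : Fin n → Fin m => makespanNorm p f k)
  have hload : ∀ i, load p f i k ≤ L := fun i =>
    (Finset.le_sup (f := fun i => load p f i k) (Finset.mem_univ i)).trans (hf.trans_le h)
  constructor
  · intro j
    refine le_trans ?_ (hload (f j))
    exact Finset.single_le_sum (f := fun j => p j k) (fun _ _ => zero_le) (by simp)
  · calc ∑ j, p j k = ∑ i, load p f i k := by
          simp only [load]
          rw [Finset.sum_fiberwise]
      _ ≤ ∑ _i : Fin m, L := Finset.sum_le_sum fun i _ => hload i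
      _ = m * L := by simp

theorem phaseAlgorithm_run {n d m : ℕ} [Nonempty (Fin m)] (a : ℝ) (α : ℝ≥0) (p : Fin n → Job d)
    (j : Fin n) : (phaseAlgorithm d m a α).run p j =
      (place a α ((after a α ((List.ofFn p).take j)).rescale (p j)) (p j)).1 := by
  have h : (List.ofFn p).take (j + 1) = (List.ofFn p).take j ++ [p j] := by
    rw [List.take_add_one]; simp
  simp [OnlineAlgorithm.run, phaseAlgorithm, h]

theorem after_take_succ {n d m : ℕ} [Nonempty (Fin m)] (a : ℝ) (α : ℝ≥0) (p : Fin n → Job d)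
    (j : Fin n) : (after a α ((List.ofFn p).take (j + 1)) : PhaseState d m) =
      (place a α ((after a α ((List.ofFn p).take j)).rescale (p j)) (p j)).2 := by
  have h : (List.ofFn p).take (j + 1) = (List.ofFn p).take j ++ [p j] := by
    rw [List.take_add_one]; simp
  rw [h, after, List.foldl_append]; rfl

/-- The load is at most `2 * (α + 2)` times the guess, and the guess is at most twice the optimum. -/
theorem phaseAlgorithm_isCompetitive {d m : ℕ} [Nonempty (Fin m)] {a : ℝ} {α : ℝ≥0}
    (ha : Real.exp 1 ≤ a) (hα : d * d * Real.exp (a - 1) ≤ (a / Real.exp 1) ^ (α : ℝ)) :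
    (phaseAlgorithm d m a α).IsCompetitive (4 * (α + 2)) := by
  intro n p L hL k
  have hm : 0 < m := Fin.pos_iff_nonempty.2 ‹_›
  have hjob : ∀ j k, p j k ≤ L := fun j k => (le_and_sum_le_of_optNorm_le (hL k)).1 j
  have hvol : ∀ k, ∑ j, p j k ≤ m * L := fun k => (le_and_sum_le_of_optNorm_le (hL k)).2
  set f := (phaseAlgorithm d m a α).run p with hf
  have key : ∀ t ≤ n,
      Inv a α (after a α ((List.ofFn p).take t))
        (fun i k => ∑ j with j.val < t ∧ f j = i, p j k) ∧
      (∀ k, ∑ i, (after a α ((List.ofFn p).take t) : PhaseState d m).virt i k ≤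
        ∑ j with j.val < t, p j k) ∧
      (after a α ((List.ofFn p).take t) : PhaseState d m).scale ≤ 2 * L := by
    intro t
    induction t with
    | zero =>
      intro _
      refine ⟨inv_zero fun i k => by simp, fun k => by simp [after], by simp [after]⟩
    | succ t ih =>
      intro ht
      obtain ⟨h1, h2, h3⟩ := ih (by omega)
      set j : Fin n := ⟨t, ht⟩ with hj
      set s : PhaseState d m := after a α ((List.ofFn p).take t) with hs
      have hnext : (after a α ((List.ofFn p).take (t + 1)) : PhaseState d m) =
        (place a α (s.rescale (p j)) (p j)).2 := after_take_succ a α p j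
      have hfj : f j = (place a α (s.rescale (p j)) (p j)).1 := phaseAlgorithm_run a α p j
      have hsum : ∀ k, ∑ j' with j'.val < t + 1, p j' k = ∑ j' with j'.val < t, p j' k + p j k := by
        intro k
        have : (Finset.univ.filter fun j' : Fin n => j'.val < t + 1) =
            insert j (Finset.univ.filter fun j' : Fin n => j'.val < t) := by
          ext j'; simp [hj, Fin.ext_iff]; omega
        rw [this, Finset.sum_insert (by simp [hj]), add_comm]
      have hM : lowerBound s.virt (p j) ≤ L := by
        refine Finset.sup_le fun k _ => max_le (hjob j k) ?_
        rw [div_le_iff₀ (by exact_mod_cast hm), mul_comm]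
        calc ∑ i, s.virt i k + p j k ≤ ∑ j' with j'.val < t, p j' k + p j k := by gcongr; exact h2 k
          _ = ∑ j' with j'.val < t + 1, p j' k := (hsum k).symm
          _ ≤ ∑ j', p j' k := Finset.sum_le_sum_of_subset (Finset.filter_subset _ _)
          _ ≤ _ := hvol k
      rw [hnext]
      refine ⟨?_, fun k => ?_, ?_⟩
      · convert (h1.rescale (p j)).place ha hα (p j) (lowerBound_rescale_le s (p j)) using 1
        ext1 i; ext1 k
        rw [← hfj, addAt]
        by_cases hi : i = f j
        · have : (Finset.univ.filter fun j' : Fin n => j'.val < t + 1 ∧ f j' = i) =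
              insert j (Finset.univ.filter fun j' : Fin n => j'.val < t ∧ f j' = i) := by
            ext j'
            simp only [Finset.mem_filter, Finset.mem_univ, true_and, Finset.mem_insert]
            constructor
            · rintro ⟨h, h'⟩
              rcases Nat.lt_succ_iff_lt_or_eq.1 h with h | h
              · exact Or.inr ⟨h, h'⟩
              · exact Or.inl (Fin.ext h)
            · rintro (rfl | h)
              · exact ⟨by simp [hj], hi.symm⟩
              · exact ⟨by omega, h.2⟩
          rw [this, Finset.sum_insert (by simp [hj]), if_pos hi, add_comm]
        · rw [if_neg hi, add_zero]
          refine Finset.sum_congr ?_ fun _ _ => rfl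
          ext j'
          simp only [Finset.mem_filter, Finset.mem_univ, true_and]
          constructor
          · rintro ⟨h, h'⟩
            refine ⟨lt_of_le_of_ne (Nat.lt_succ_iff.1 h) fun h => hi ?_, h'⟩
            rw [← h', show j' = j from Fin.ext h]
          · rintro ⟨h, h'⟩
            exact ⟨by omega, h'⟩
      · rw [place_snd_virt, sum_addAt, hsum]
        gcongr
        refine le_trans ?_ (h2 k)
        unfold PhaseState.rescale
        split_ifs
        · exact le_rfl
        · simp
      · rw [place_snd_scale]
        unfold PhaseState.rescale
        split_ifs
        · exact h3
        · dsimp only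
          gcongr
  obtain ⟨h1, -, h3⟩ := key n le_rfl
  have : makespanNorm p f k ≤ 4 * (α + 2) * L := by
    refine Finset.sup_le fun i _ => ?_
    have h := h1.load_le_scale i k
    have hl : load p f i k = ∑ j with j.val < n ∧ f j = i, p j k := by
      simp [load]
    rw [hl]
    calc _ ≤ 2 * (α + 2) * _ := h
      _ ≤ 2 * (α + 2) * (2 * L) := by gcongr
      _ = _ := by ring
  exact_mod_cast this

/-! ### Monochromatic cliques -/

section Clique

variable {t : ℕ}

/-- The colours `(x v).1` of those vertices in `Q` that `f` puts into the bin `i`. -/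
def colorsOn (x : ℕ → Fin t × Fin t) (f : ℕ → Fin t) (Q : Finset ℕ) (i : Fin t) : Finset (Fin t) :=
  (Q.filter fun v => f v = i).image fun v => (x v).1

/-- The vertex `τ` is kept if its colour is new among the vertices kept in its bin and neither side
of the bin has `s` vertices yet. -/
def Accepts (x : ℕ → Fin t × Fin t) (f : ℕ → Fin t) (s : ℕ) (Q : Bool → Finset ℕ) (τ : ℕ) : Prop :=
  (∀ e, (x τ).1 ∉ colorsOn x f (Q e) (f τ)) ∧ ∀ e, ((Q e).filter fun v => f v = f τ).card < s

open Classical in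
/-- The kept vertices among the first `τ` ones, split into two sides. Within each bin, each side is a
clique of size at most `s`: since the colours in a bin are distinct, a kept vertex `v` misses at
most one of the earlier ones, namely the one of colour `(x v).2`, and goes to the side without
it. -/
def kept (x : ℕ → Fin t × Fin t) (f : ℕ → Fin t) (s : ℕ) : ℕ → Bool → Finset ℕ
  | 0 => fun _ => ∅
  | τ + 1 => fun e =>
      if Accepts x f s (kept x f s τ) τ ∧
          e = decide ((x τ).2 ∈ colorsOn x f (kept x f s τ false) (f τ)) then
        insert τ (kept x f s τ e)
      else kept x f s τ e

/-- The number of kept vertices. -/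
def numKept (x : ℕ → Fin t × Fin t) (f : ℕ → Fin t) (s τ : ℕ) : ℕ :=
  ∑ e, (kept x f s τ e).card

/-- No side of a bin has reached `s` vertices. -/
def Unfinished (x : ℕ → Fin t × Fin t) (f : ℕ → Fin t) (s τ : ℕ) : Prop :=
  ∀ i e, ((kept x f s τ e).filter fun v => f v = i).card < s

variable {x : ℕ → Fin t × Fin t} {f : ℕ → Fin t} {s : ℕ}

theorem lt_of_mem_kept {τ v : ℕ} {e : Bool} (h : v ∈ kept x f s τ e) : v < τ := by
  induction τ with
  | zero => simp [kept] at h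
  | succ τ ih =>
    simp only [kept] at h
    split_ifs at h with hc
    · rcases Finset.mem_insert.1 h with rfl | h
      · exact Nat.lt_succ_self _
      · exact (ih h).trans (Nat.lt_succ_self _)
    · exact (ih h).trans (Nat.lt_succ_self _)

theorem colorsOn_congr {x' : ℕ → Fin t × Fin t} {f' : ℕ → Fin t} {Q : Finset ℕ} {τ : ℕ}
    (hQ : ∀ v ∈ Q, v < τ) (hx : ∀ v < τ, x v = x' v) (hf : ∀ v < τ, f v = f' v) (i : Fin t) :
    colorsOn x f Q i = colorsOn x' f' Q i := by
  unfold colorsOn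
  rw [Finset.filter_congr fun v hv => by rw [hf v (hQ v hv)]]
  exact Finset.image_congr fun v hv => by
    rw [hx v (hQ v (Finset.mem_filter.1 hv).1)]

theorem card_filter_congr {f' : ℕ → Fin t} {Q : Finset ℕ} {τ : ℕ}
    (hQ : ∀ v ∈ Q, v < τ) (hf : ∀ v < τ, f v = f' v) (i : Fin t) :
    (Q.filter fun v => f v = i).card = (Q.filter fun v => f' v = i).card := by
  rw [Finset.filter_congr fun v hv => by rw [hf v (hQ v hv)]]

theorem kept_congr {x' : ℕ → Fin t × Fin t} {f' : ℕ → Fin t} {τ : ℕ}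
    (hx : ∀ v < τ, x v = x' v) (hf : ∀ v < τ, f v = f' v) : kept x f s τ = kept x' f' s τ := by
  classical
  induction τ with
  | zero => rfl
  | succ τ ih =>
    have ih := ih (fun v hv => hx v (by omega)) (fun v hv => hf v (by omega))
    have hlt : ∀ e, ∀ v ∈ kept x' f' s τ e, v < τ + 1 := fun e v hv => by
      have := lt_of_mem_kept hv; omega
    have hcol : ∀ e i, colorsOn x f (kept x' f' s τ e) i = colorsOn x' f' (kept x' f' s τ e) i :=
      fun e i => colorsOn_congr (hlt e) hx hf i
    have hcard : ∀ e i, ((kept x' f' s τ e).filter fun v => f v = i).card =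
        ((kept x' f' s τ e).filter fun v => f' v = i).card :=
      fun e i => card_filter_congr (hlt e) hf i
    funext e
    simp only [kept, ih]
    refine if_congr ?_ rfl rfl
    simp only [Accepts, hcol, hcard, hx τ (Nat.lt_succ_self τ), hf τ (Nat.lt_succ_self τ)]

theorem numKept_congr {x' : ℕ → Fin t × Fin t} {f' : ℕ → Fin t} {τ : ℕ}
    (hx : ∀ v < τ, x v = x' v) (hf : ∀ v < τ, f v = f' v) :
    numKept x f s τ = numKept x' f' s τ := by
  unfold numKept; rw [kept_congr hx hf]

theorem unfinished_congr {x' : ℕ → Fin t × Fin t} {f' : ℕ → Fin t} {τ : ℕ}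
    (hx : ∀ v < τ, x v = x' v) (hf : ∀ v < τ, f v = f' v) :
    Unfinished x f s τ ↔ Unfinished x' f' s τ := by
  unfold Unfinished
  rw [kept_congr hx hf]
  refine forall_congr' fun i => forall_congr' fun e => ?_
  rw [card_filter_congr (fun v hv => lt_of_mem_kept hv) hf i]

theorem kept_subset_succ (τ : ℕ) (e : Bool) : kept x f s τ e ⊆ kept x f s (τ + 1) e := by
  simp only [kept]
  split_ifs
  · exact Finset.subset_insert _ _
  · exact Finset.Subset.refl _

theorem Unfinished.of_succ {τ : ℕ} (h : Unfinished x f s (τ + 1)) : Unfinished x f s τ :=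
  fun i e => (Finset.card_le_card
    (Finset.filter_subset_filter _ (kept_subset_succ τ e))).trans_lt (h i e)

open Classical in
/-- An accepted vertex is put on exactly one of the two sides. -/
theorem numKept_succ (τ : ℕ) : numKept x f s (τ + 1) =
    numKept x f s τ + if Accepts x f s (kept x f s τ) τ then 1 else 0 := by
  have hτ : ∀ e, τ ∉ kept x f s τ e := fun e h => (lt_of_mem_kept h).false
  by_cases h : Accepts x f s (kept x f s τ) τ
  · simp only [numKept, kept, h, true_and, if_true, Fintype.sum_bool]
    by_cases hb : (x τ).2 ∈ colorsOn x f (kept x f s τ false) (f τ)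
    · simp [hb, hτ]; omega
    · simp [hb, hτ]; omega
  · simp [numKept, kept, h]

theorem card_filter_kept_le (τ : ℕ) (i : Fin t) (e : Bool) :
    ((kept x f s τ e).filter fun v => f v = i).card ≤ s := by
  induction τ with
  | zero => simp [kept]
  | succ τ ih =>
    simp only [kept]
    split_ifs with h
    · rw [Finset.filter_insert]
      split_ifs with hi
      · refine (Finset.card_insert_le _ _).trans ?_
        have := h.1.2 e
        rw [hi] at this
        omega
      · exact ih
    · exact ih

theorem numKept_le (τ : ℕ) : numKept x f s τ ≤ 2 * (t * s) := by
  have h : ∀ e, (kept x f s τ e).card ≤ t * s := fun e => by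
    rw [Finset.card_eq_sum_card_fiberwise (f := f) (t := Finset.univ) (fun _ _ => by simp)]
    calc _ ≤ ∑ _i : Fin t, s := Finset.sum_le_sum fun i _ => card_filter_kept_le τ i e
      _ = t * s := by simp
  rw [numKept, Fintype.sum_bool]
  have := h true
  have := h false
  omega

theorem card_colorsOn_kept_le (τ : ℕ) (i : Fin t) (e : Bool) :
    (colorsOn x f (kept x f s τ e) i).card ≤ s :=
  Finset.card_image_le.trans (card_filter_kept_le τ i e)

/-- The kept vertices in a bin have distinct colours, and each side of a bin is a clique. -/
theorem kept_spec (τ : ℕ) :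
    Disjoint (kept x f s τ false) (kept x f s τ true) ∧
    (∀ e e', ∀ v ∈ kept x f s τ e, ∀ w ∈ kept x f s τ e', v < w → f v = f w →
      (x v).1 ≠ (x w).1) ∧
    ∀ e, ∀ v ∈ kept x f s τ e, ∀ w ∈ kept x f s τ e, v < w → f v = f w → (x v).1 ≠ (x w).2 := by
  classical
  induction τ with
  | zero => simp [kept]
  | succ τ ih =>
    obtain ⟨h1, h2, h3⟩ := ih
    have hmem : ∀ e v, v ∈ kept x f s (τ + 1) e → v ∈ kept x f s τ e ∨ (v = τ ∧
        Accepts x f s (kept x f s τ) τ ∧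
          e = decide ((x τ).2 ∈ colorsOn x f (kept x f s τ false) (f τ))) := by
      intro e v hv
      simp only [kept] at hv
      split_ifs at hv with hc
      · rcases Finset.mem_insert.1 hv with rfl | hv
        · exact Or.inr ⟨rfl, hc⟩
        · exact Or.inl hv
      · exact Or.inl hv
    have hlt : ∀ {e v}, v ∈ kept x f s τ e → v < τ := lt_of_mem_kept
    refine ⟨?_, ?_, ?_⟩
    · rw [Finset.disjoint_left] at h1 ⊢
      intro v hv hv'
      rcases hmem _ _ hv with hv | ⟨rfl, -, hv⟩ <;> rcases hmem _ _ hv' with hv' | ⟨h, -, hv'⟩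
      · exact h1 hv hv'
      · have := hlt hv; omega
      · exact (hlt hv').false
      · rw [← hv'] at hv; exact absurd hv (by decide)
    · intro e e' v hv w hw hvw hf
      rcases hmem _ _ hv with hv | ⟨rfl, -, -⟩ <;> rcases hmem _ _ hw with hw | ⟨rfl, ha, -⟩
      · exact h2 e e' v hv w hw hvw hf
      · exact fun h => ha.1 e (Finset.mem_image.2 ⟨v, Finset.mem_filter.2 ⟨hv, hf⟩, h⟩)
      · have := hlt hw; omega
      · omega
    · intro e v hv w hw hvw hf
      rcases hmem _ _ hv with hv | ⟨rfl, -, -⟩ <;> rcases hmem _ _ hw with hw | ⟨rfl, -, he⟩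
      · exact h3 e v hv w hw hvw hf
      · intro h
        have hb : (x w).2 ∈ colorsOn x f (kept x f s w e) (f w) :=
          Finset.mem_image.2 ⟨v, Finset.mem_filter.2 ⟨hv, hf⟩, h⟩
        cases e with
        | false => simp [hb] at he
        | true =>
          -- the colour `(x w).2` occurs on both sides, which contradicts distinctness
          have he := of_decide_eq_true he.symm
          obtain ⟨v', hv', h'⟩ := Finset.mem_image.1 he
          obtain ⟨hv', hf'⟩ := Finset.mem_filter.1 hv'
          rcases lt_trichotomy v v' with hlt' | rfl | hlt'
          · exact h2 _ _ v hv v' hv' hlt' (hf.trans hf'.symm) (h.trans h'.symm)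
          · exact Finset.disjoint_left.1 h1 hv' hv
          · exact h2 _ _ v' hv' v hv hlt' (hf'.trans hf.symm) (h'.trans h.symm)
      · have := hlt hw; omega
      · omega

/-- If the bin of a random pair of colours does not depend on the order of the pair, then with
probability at least `1/4` the first colour is new in this bin, provided that the bins have few
colours: for at most half of the pairs some bin contains both colours, and for each other pair the
order or its reverse puts a new colour first. -/
theorem sq_le_four_mul_card_new (s : ℕ) (ht : 8 * s ^ 2 ≤ t) (H : Fin t → Finset (Fin t))
    (hH : ∀ i, (H i).card ≤ 2 * s) (g : Fin t × Fin t → Fin t) (hg : ∀ z, g z.swap = g z) :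
    t ^ 2 ≤ 4 * (Finset.univ.filter fun z : Fin t × Fin t => z.1 ∉ H (g z)).card := by
  classical
  set N := (Finset.univ.filter fun z : Fin t × Fin t => z.1 ∉ H (g z)) with hN
  have hswap : (Finset.univ.filter fun z : Fin t × Fin t => z.2 ∉ H (g z)).card = N.card := by
    refine Finset.card_bij' (fun z _ => z.swap) (fun z _ => z.swap) ?_ ?_ ?_ ?_
    · intro z hz; simpa [hN, hg] using hz
    · intro z hz; simpa [hN, hg] using hz
    · simp
    · simp
  have hcover : (Finset.univ : Finset (Fin t × Fin t)) ⊆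
      (N ∪ Finset.univ.filter fun z : Fin t × Fin t => z.2 ∉ H (g z)) ∪
        Finset.univ.biUnion fun i => H i ×ˢ H i := by
    intro z _
    by_cases h1 : z.1 ∈ H (g z)
    · by_cases h2 : z.2 ∈ H (g z)
      · refine Finset.mem_union_right _ (Finset.mem_biUnion.2 ⟨g z, Finset.mem_univ _, ?_⟩)
        exact Finset.mem_product.2 ⟨h1, h2⟩
      · exact Finset.mem_union_left _ (Finset.mem_union_right _ (by simp [h2]))
    · exact Finset.mem_union_left _ (Finset.mem_union_left _ (by simp [hN, h1]))
  have hbi : (Finset.univ.biUnion fun i => H i ×ˢ H i).card ≤ t * (4 * s ^ 2) := by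
    refine Finset.card_biUnion_le.trans ?_
    calc ∑ i, (H i ×ˢ H i).card ≤ ∑ _i : Fin t, 4 * s ^ 2 := Finset.sum_le_sum fun i _ => by
          rw [Finset.card_product]
          calc _ ≤ (2 * s) * (2 * s) := Nat.mul_le_mul (hH i) (hH i)
            _ = _ := by ring
      _ = _ := by simp
  have h := (Finset.card_le_card hcover).trans ((Finset.card_union_le _ _).trans
    (Nat.add_le_add_right (Finset.card_union_le _ _) _))
  rw [hswap] at h
  simp only [Finset.card_univ, Fintype.card_prod, Fintype.card_fin] at h
  nlinarith

/-! ### The scheduling instance -/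

/-- The vertices of `D` up to `v` form a clique, where `w < w'` are adjacent if the colour `(x w).1`
is not in the palette `{(x w').1, (x w').2}`. -/
def CliqueUpTo (x : ℕ → Fin t × Fin t) (D : Finset ℕ) (v : ℕ) : Prop :=
  ∀ w ∈ D, ∀ w' ∈ D, w < w' → w' ≤ v → (x w).1 ≠ (x w').1 ∧ (x w).1 ≠ (x w').2

open Classical in
/-- The jobs are the vertices. Each dimension `k` tests a set `D k` of vertices: as long as its
vertices form a clique, they have load `1`. -/
def cliqueInstance {d : ℕ} (n : ℕ) (D : Fin d → Finset ℕ) (x : ℕ → Fin t × Fin t) :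
    Fin n → Job d :=
  fun v k => if v.val ∈ D k ∧ CliqueUpTo x (D k) v then 1 else 0

theorem CliqueUpTo.congr {x x' : ℕ → Fin t × Fin t} {D : Finset ℕ} {v : ℕ}
    (hlt : ∀ w < v, x w = x' w) (hv : x v = x' v ∨ x v = (x' v).swap) (h : CliqueUpTo x D v) :
    CliqueUpTo x' D v := by
  intro w hw w' hw' hww' hle
  have := h w hw w' hw' hww' hle
  rw [hlt w (by omega)] at this
  rcases hle.lt_or_eq with h1 | rfl
  · rwa [hlt w' h1] at this
  · rcases hv with hv | hv
    · rwa [hv] at this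
    · rw [hv] at this
      exact this.symm

theorem cliqueInstance_congr {d n : ℕ} {D : Fin d → Finset ℕ} {x x' : ℕ → Fin t × Fin t}
    {v : Fin n} (hlt : ∀ w < v.val, x w = x' w) (hv : x v = x' v ∨ x v = (x' v).swap) :
    cliqueInstance n D x v = cliqueInstance n D x' v := by
  classical
  have hiff : ∀ k, CliqueUpTo x (D k) v ↔ CliqueUpTo x' (D k) v := fun k =>
    ⟨CliqueUpTo.congr hlt hv, CliqueUpTo.congr (fun w hw => (hlt w hw).symm)
      (hv.imp Eq.symm fun h => by rw [h, Prod.swap_swap])⟩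
  funext k
  exact if_congr (and_congr_right fun _ => hiff k) rfl rfl

/-- The colours are a proper colouring of the graph, so that a clique contributes at most one vertex
to each machine. -/
theorem makespanNorm_color_le {d n : ℕ} (D : Fin d → Finset ℕ) (x : ℕ → Fin t × Fin t)
    (k : Fin d) : makespanNorm (cliqueInstance n D x) (fun v => (x v).1) k ≤ 1 := by
  refine Finset.sup_le fun i _ => ?_
  unfold load
  by_cases h : ∃ j : Fin n, (x j).1 = i ∧ cliqueInstance n D x j k ≠ 0
  · obtain ⟨j, hj, hjk⟩ := h
    rw [Finset.sum_eq_single_of_mem j (by simp [hj])]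
    · unfold cliqueInstance; split_ifs <;> simp
    · intro j' hj' hne
      by_contra hjk'
      have hj' := (Finset.mem_filter.1 hj').2
      simp only [cliqueInstance, ne_eq, ite_eq_right_iff, one_ne_zero, imp_false, not_not]
        at hjk hjk'
      rcases lt_or_gt_of_ne (Fin.val_injective.ne hne) with hlt | hlt
      · exact (hjk.2 _ hjk'.1 _ hjk.1 hlt le_rfl).1 (hj'.trans hj.symm)
      · exact (hjk'.2 _ hjk.1 _ hjk'.1 hlt le_rfl).1 (hj.trans hj'.symm)
  · push Not at h
    rw [Finset.sum_eq_zero fun j hj => h j (Finset.mem_filter.1 hj).2]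
    exact zero_le_one

theorem one_le_makespanNorm {d n : ℕ} {D : Fin d → Finset ℕ} (x : ℕ → Fin t × Fin t)
    {k : Fin d} (hne : (D k).Nonempty) (hD : ∀ v ∈ D k, v < n) (g : Fin n → Fin t) :
    1 ≤ makespanNorm (cliqueInstance n D x) g k := by
  -- the first vertex of `D k` has load `1`
  have hmem := (D k).min'_mem hne
  set v : Fin n := ⟨(D k).min' hne, hD _ hmem⟩ with hv
  have h1 : cliqueInstance n D x v k = 1 := by
    refine if_pos ⟨hmem, fun w hw w' _ hlt hle => ?_⟩
    have := (D k).min'_le w hw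
    simp only [hv] at hle
    omega
  calc 1 = cliqueInstance n D x v k := h1.symm
    _ ≤ load (cliqueInstance n D x) g (g v) k :=
        Finset.single_le_sum (f := fun j => cliqueInstance n D x j k) (fun _ _ => zero_le)
          (by simp)
    _ ≤ _ := Finset.le_sup (f := fun i => load (cliqueInstance n D x) g i k) (Finset.mem_univ _)

theorem isNormalized_of_makespanNorm {n d m : ℕ} {p : Fin n → Job d}
    (hp : ∀ (g : Fin n → Fin m) k, 1 ≤ makespanNorm p g k) (g : Fin n → Fin m)
    (hg : ∀ k, makespanNorm p g k ≤ 1) : IsNormalized m p := by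
  have : Nonempty (Fin n → Fin m) := ⟨g⟩
  refine ⟨fun k => le_antisymm ?_ (le_ciInf fun f => hp f k),
    g, fun k => (hg k).antisymm (hp g k)⟩
  exact (ciInf_le (OrderBot.bddBelow _) g).trans (hg k)

theorem isNormalized_cliqueInstance {d n : ℕ} {D : Fin d → Finset ℕ} (x : ℕ → Fin t × Fin t)
    (hne : ∀ k, (D k).Nonempty) (hD : ∀ k, ∀ v ∈ D k, v < n) :
    IsNormalized t (cliqueInstance n D x) :=
  isNormalized_of_makespanNorm (fun g k => one_le_makespanNorm x (hne k) (hD k) g)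
    (fun v => (x v).1) fun k => makespanNorm_color_le D x k

/-- The extension of an assignment by `0` to all natural numbers. -/
def extendNat {n : ℕ} [NeZero t] (g : Fin n → Fin t) : ℕ → Fin t :=
  fun j => if h : j < n then g ⟨j, h⟩ else 0

theorem le_makespan_of_not_unfinished {d n : ℕ} [NeZero t] {D : Fin d → Finset ℕ}
    {x : ℕ → Fin t × Fin t}
    {s : ℕ} (hD : ∀ T : Finset ℕ, T.card = s → (∀ v ∈ T, v < n) → ∃ k, D k = T)
    (g : Fin n → Fin t) (h : ¬ Unfinished x (extendNat g) s n) :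
    (s : ℝ≥0) ≤ makespan (cliqueInstance n D x) g := by
  classical
  unfold Unfinished at h
  push Not at h
  obtain ⟨i, e, h⟩ := h
  set T := (kept x (extendNat g) s n e).filter fun v => extendNat g v = i with hT
  have hTn : ∀ v ∈ T, v < n := fun v hv => lt_of_mem_kept (Finset.mem_filter.1 hv).1
  have hcard : T.card = s := le_antisymm (card_filter_kept_le n i e) h
  obtain ⟨k, hk⟩ := hD T hcard hTn
  obtain ⟨-, h2, h3⟩ := kept_spec (x := x) (f := extendNat g) (s := s) n
  have hclique : ∀ v, CliqueUpTo x (D k) v := by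
    intro v w hw w' hw' hlt _
    rw [hk, hT, Finset.mem_filter] at hw hw'
    have hf := hw.2.trans hw'.2.symm
    exact ⟨h2 e e w hw.1 w' hw'.1 hlt hf, h3 e w hw.1 w' hw'.1 hlt hf⟩
  calc (s : ℝ≥0) = ∑ _v : T, 1 := by simp [hcard]
    _ = ∑ j ∈ (Finset.univ : Finset T).image (fun v => (⟨v.1, hTn v.1 v.2⟩ : Fin n)), (1 : ℝ≥0) := by
        rw [Finset.sum_image]
        intro v _ w _ hvw
        exact Subtype.ext (Fin.ext_iff.1 hvw)
    _ = ∑ j ∈ (Finset.univ : Finset T).image (fun v => (⟨v.1, hTn v.1 v.2⟩ : Fin n)),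
          cliqueInstance n D x j k := by
        refine Finset.sum_congr rfl fun j hj => ?_
        obtain ⟨v, -, rfl⟩ := Finset.mem_image.1 hj
        exact (if_pos ⟨by rw [hk]; exact v.2, hclique _⟩).symm
    _ ≤ load (cliqueInstance n D x) g i k := by
        refine Finset.sum_le_sum_of_subset fun j hj => ?_
        obtain ⟨v, -, rfl⟩ := Finset.mem_image.1 hj
        have := (Finset.mem_filter.1 v.2).2
        rw [extendNat, dif_pos (hTn v.1 v.2)] at this
        simpa using this
    _ ≤ makespanNorm (cliqueInstance n D x) g k :=
        Finset.le_sup (f := fun i => load (cliqueInstance n D x) g i k) (Finset.mem_univ _)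
    _ ≤ _ := Finset.le_sup (f := fun k => makespanNorm (cliqueInstance n D x) g k)
        (Finset.mem_univ _)

end Clique

/-! ### The adversary -/

section Adversary

variable {d m n t s : ℕ}

theorem OnlineAlgorithm.run_congr (A : OnlineAlgorithm d m) {p p' : Fin n → Job d} {j : Fin n}
    (h : ∀ i ≤ j, p i = p' i) : A.run p j = A.run p' j := by
  unfold OnlineAlgorithm.run
  congr 1
  refine List.ext_getElem (by simp) fun i h1 h2 => ?_
  simp only [List.length_take, List.length_ofFn, lt_min_iff] at h1
  simp only [List.getElem_take, List.getElem_ofFn]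
  exact h _ (Fin.le_def.2 (by simpa using Nat.lt_succ_iff.1 h1.1))

/-- The bins that the algorithm `A` chooses on the instance given by `x`. -/
def response [NeZero t] (n : ℕ) (D : Fin d → Finset ℕ) (A : OnlineAlgorithm d t)
    (x : ℕ → Fin t × Fin t) : ℕ → Fin t :=
  extendNat (A.run (cliqueInstance n D x))

/-- The response to the vertex `v` depends only on the pairs up to `v`, and not on the order of the
pair at `v`: the job reveals the palette of the vertex, but not its colour. -/
theorem response_congr [NeZero t] {D : Fin d → Finset ℕ} {A : OnlineAlgorithm d t}
    {x x' : ℕ → Fin t × Fin t} {v : ℕ} (hlt : ∀ w < v, x w = x' w)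
    (hv : x v = x' v ∨ x v = (x' v).swap) : response n D A x v = response n D A x' v := by
  unfold response extendNat
  split_ifs with h
  · refine A.run_congr fun i hi => ?_
    have hi : i.val ≤ v := hi
    refine cliqueInstance_congr (fun w hw => hlt w (by omega)) ?_
    rcases hi.lt_or_eq with hi | rfl
    · exact Or.inl (hlt _ hi)
    · exact hv
  · rfl

open Classical in
/-- As long as the game is unfinished, a random pair at the vertex `τ` is expected to increase the
number of kept vertices by at least `1/4`. -/
theorem numKept_add_le_sum [NeZero t] (ht : 8 * s ^ 2 ≤ t) (D : Fin d → Finset ℕ)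
    (A : OnlineAlgorithm d t) (x : ℕ → Fin t × Fin t) (τ : ℕ) :
    (t : ℝ) ^ 2 * (numKept x (response n D A x) s τ +
      1 / 4 * if Unfinished x (response n D A x) s τ then 1 else 0) ≤
    ∑ z, (numKept (Function.update x τ z) (response n D A (Function.update x τ z)) s (τ + 1) : ℝ)
    := by
  set f := response n D A x with hf
  have hxz : ∀ z, ∀ v < τ, Function.update x τ z v = x v := fun z v hv =>
    Function.update_of_ne hv.ne _ _
  have hfz : ∀ z, ∀ v < τ, response n D A (Function.update x τ z) v = f v := fun z v hv =>
    response_congr (fun w hw => hxz z w (hw.trans hv)) (Or.inl (hxz z v hv))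
  have hkept : ∀ z, kept (Function.update x τ z) (response n D A (Function.update x τ z)) s τ =
      kept x f s τ := fun z => kept_congr (hxz z) (hfz z)
  have hnum : ∀ z, numKept (Function.update x τ z) (response n D A (Function.update x τ z)) s τ =
      numKept x f s τ := fun z => numKept_congr (hxz z) (hfz z)
  simp only [numKept_succ, hnum, hkept]
  push_cast
  rw [Finset.sum_add_distrib, mul_add]
  have hcard : (Finset.univ : Finset (Fin t × Fin t)).card = t ^ 2 := by simp [sq]
  refine add_le_add (le_of_eq ?_) ?_
  · rw [Finset.sum_const, hcard, nsmul_eq_mul]; push_cast; ring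
  · split_ifs with hU
    · set g : Fin t × Fin t → Fin t := fun z => response n D A (Function.update x τ z) τ with hg
      set H : Fin t → Finset (Fin t) := fun i =>
        colorsOn x f (kept x f s τ false) i ∪ colorsOn x f (kept x f s τ true) i with hH
      have hcount := sq_le_four_mul_card_new s ht H (fun i => by
          refine (Finset.card_union_le _ _).trans ?_
          have := card_colorsOn_kept_le (x := x) (f := f) (s := s) τ i false
          have := card_colorsOn_kept_le (x := x) (f := f) (s := s) τ i true
          omega) g (fun z => response_congr (fun w hw => by rw [hxz _ w hw, hxz _ w hw])
            (Or.inr (by simp)))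
      have hacc : ∀ z, z.1 ∉ H (g z) → Accepts (Function.update x τ z)
          (response n D A (Function.update x τ z)) s (kept x f s τ) τ := by
        intro z hz
        simp only [hH, Finset.mem_union, not_or] at hz
        have hcol : ∀ e i, colorsOn (Function.update x τ z)
            (response n D A (Function.update x τ z)) (kept x f s τ e) i =
            colorsOn x f (kept x f s τ e) i := fun e i =>
          colorsOn_congr (fun v hv => lt_of_mem_kept hv) (hxz z) (hfz z) i
        refine ⟨fun e => ?_, fun e => ?_⟩
        · rw [hcol, Function.update_self]
          cases e
          · exact hz.1
          · exact hz.2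
        · rw [card_filter_congr (fun v hv => lt_of_mem_kept hv) (hfz z)]
          exact hU _ e
      have hle : ((Finset.univ.filter fun z : Fin t × Fin t => z.1 ∉ H (g z)).card : ℝ) ≤
          ∑ z, (if Accepts (Function.update x τ z)
            (response n D A (Function.update x τ z)) s (kept x f s τ) τ then (1 : ℝ) else 0) := by
        rw [Finset.card_filter]
        push_cast
        refine Finset.sum_le_sum fun z _ => ?_
        by_cases hz : z.1 ∉ H (g z)
        · rw [if_pos hz, if_pos (hacc z hz)]
        · rw [if_neg hz]; split_ifs <;> norm_num
      have : (t : ℝ) ^ 2 ≤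
          4 * (Finset.univ.filter fun z : Fin t × Fin t => z.1 ∉ H (g z)).card := by
        exact_mod_cast hcount
      linarith
    · rw [mul_zero, mul_zero]
      exact Finset.sum_nonneg fun z _ => by split_ifs <;> norm_num

theorem RandomizedOnlineAlgorithm.integrable_run (R : RandomizedOnlineAlgorithm.{u} d m)
    (p : Fin n → Job d) (F : (Fin n → Fin m) → ℝ) :
    Integrable (fun ω => F ((R.alg ω).run p)) R.μ := by
  have hrun : Measurable fun ω => (R.alg ω).run p :=
    measurable_pi_iff.2 fun j => R.measurable_choose _
  refine Integrable.of_bound ((Measurable.of_discrete (f := F)).comp hrun).aestronglyMeasurable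
    (∑ g, ‖F g‖) (Filter.Eventually.of_forall fun ω => ?_)
  exact Finset.single_le_sum (f := fun g => ‖F g‖) (fun _ _ => norm_nonneg _) (Finset.mem_univ _)

open Classical in
/-- The adversary fixes the pairs one after another such that the expected number of kept vertices
grows at the rate at which it does for random pairs. -/
theorem exists_adversary [NeZero t] (ht : 8 * s ^ 2 ≤ t) (D : Fin d → Finset ℕ)
    (R : RandomizedOnlineAlgorithm.{u} d t) (τ : ℕ) :
    ∃ x : ℕ → Fin t × Fin t,
      τ / 4 * ∫ ω, (if Unfinished x (response n D (R.alg ω) x) s τ then (1 : ℝ) else 0) ∂(R.μ) ≤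
        ∫ ω, (numKept x (response n D (R.alg ω) x) s τ : ℝ) ∂(R.μ) := by
  have hI1 : ∀ x τ, Integrable (fun ω =>
      if Unfinished x (response n D (R.alg ω) x) s τ then (1 : ℝ) else 0) R.μ := fun x τ =>
    R.integrable_run (cliqueInstance n D x)
      fun g => if Unfinished x (extendNat g) s τ then (1 : ℝ) else 0
  have hI2 : ∀ x τ, Integrable (fun ω => (numKept x (response n D (R.alg ω) x) s τ : ℝ)) R.μ :=
    fun x τ => R.integrable_run (cliqueInstance n D x) fun g => (numKept x (extendNat g) s τ : ℝ)
  induction τ with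
  | zero =>
    refine ⟨fun _ => 0, ?_⟩
    simp only [Nat.cast_zero, zero_div, zero_mul]
    exact integral_nonneg fun ω => Nat.cast_nonneg _
  | succ τ ih =>
    obtain ⟨x, hx⟩ := ih
    set I := ∫ ω, (if Unfinished x (response n D (R.alg ω) x) s τ then (1 : ℝ) else 0) ∂(R.μ) with hI
    set K := ∫ ω, (numKept x (response n D (R.alg ω) x) s τ : ℝ) ∂(R.μ) with hK
    have hsum : ∑ _z : Fin t × Fin t, (K + 1 / 4 * I) ≤ ∑ z, ∫ ω, (numKept (Function.update x τ z)
        (response n D (R.alg ω) (Function.update x τ z)) s (τ + 1) : ℝ) ∂(R.μ) := by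
      rw [← integral_finsetSum _ fun z _ => hI2 _ _, Finset.sum_const, nsmul_eq_mul, hK, hI,
        ← integral_const_mul, ← integral_add (hI2 _ _) ((hI1 _ _).const_mul _),
        ← integral_const_mul]
      refine integral_mono (((hI2 _ _).add ((hI1 _ _).const_mul _)).const_mul _)
        (integrable_finsetSum _ fun z _ => hI2 _ _) fun ω => ?_
      refine le_trans (le_of_eq ?_) (numKept_add_le_sum ht D (R.alg ω) x τ)
      simp [sq]
    obtain ⟨z, -, hz⟩ := Finset.exists_le_of_sum_le Finset.univ_nonempty hsum
    refine ⟨Function.update x τ z, le_trans ?_ hz⟩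
    have hxz : ∀ v < τ, Function.update x τ z v = x v := fun v hv =>
      Function.update_of_ne hv.ne _ _
    have hmono : ∫ ω, (if Unfinished (Function.update x τ z)
        (response n D (R.alg ω) (Function.update x τ z)) s (τ + 1) then (1 : ℝ) else 0) ∂(R.μ) ≤
        I := by
      refine integral_mono (hI1 _ _) (hI1 _ _) fun ω => ?_
      dsimp only
      have himp : Unfinished (Function.update x τ z)
          (response n D (R.alg ω) (Function.update x τ z)) s (τ + 1) →
          Unfinished x (response n D (R.alg ω) x) s τ := fun h =>
        (unfinished_congr hxz fun v hv =>
          response_congr (fun w hw => hxz w (hw.trans hv)) (Or.inl (hxz v hv))).1 h.of_succ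
      split_ifs with h1 h2 h2
      · exact le_rfl
      · exact absurd (himp h1) h2
      · exact zero_le_one
      · exact le_rfl
    calc ((τ + 1 : ℕ) : ℝ) / 4 * _ ≤ ((τ + 1 : ℕ) : ℝ) / 4 * I := by gcongr
      _ = τ / 4 * I + 1 / 4 * I := by push_cast; ring
      _ ≤ K + 1 / 4 * I := by gcongr

/-- If there are at least `n ^ s` dimensions, they can test every set of `s` among `n` vertices. -/
theorem exists_dimension_family (hn : 0 < n) (hs : 0 < s) (hd : n ^ s ≤ d) :
    ∃ D : Fin d → Finset ℕ, (∀ k, (D k).Nonempty) ∧ (∀ k, ∀ v ∈ D k, v < n) ∧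
      ∀ T : Finset ℕ, T.card = s → (∀ v ∈ T, v < n) → ∃ k, D k = T := by
  have : Nonempty (Fin n) := ⟨⟨0, hn⟩⟩
  have : Nonempty (Fin s) := ⟨⟨0, hs⟩⟩
  obtain ⟨e⟩ := Function.Embedding.nonempty_of_card_le (α := Fin s → Fin n) (β := Fin d)
    (by simpa using hd)
  refine ⟨fun k => Finset.univ.image fun j => (Function.invFun e k j : ℕ), fun k => ?_,
    fun k v hv => ?_, fun T hT hTn => ?_⟩
  · exact Finset.univ_nonempty.image _
  · obtain ⟨j, -, rfl⟩ := Finset.mem_image.1 hv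
    exact Fin.is_lt _
  · obtain ⟨k, hk⟩ := Function.invFun_surjective e.injective
      fun j => ⟨T.orderEmbOfFin hT j, hTn _ (T.orderEmbOfFin_mem hT j)⟩
    refine ⟨k, ?_⟩
    dsimp only
    rw [hk]
    exact Finset.coe_injective (by simp)

/-- With `8 * s ^ 2` machines at most `16 * s ^ 3` vertices are kept. On the other hand, each of the
`128 * s ^ 3` vertices raises their expected number by a quarter of the probability that no
monochromatic clique of size `s` has appeared in the end. So this probability is at most `1/2`. -/
theorem exists_instance_half_le_expectedMakespan (hs : 0 < s)
    (hd : (128 * s ^ 3) ^ s ≤ d) (R : RandomizedOnlineAlgorithm.{u} d (8 * s ^ 2)) :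
    ∃ p : Fin (128 * s ^ 3) → Job d, IsNormalized (8 * s ^ 2) p ∧
      (s : ℝ) / 2 ≤ R.expectedMakespan p := by
  classical
  have : NeZero (8 * s ^ 2) := ⟨by positivity⟩
  obtain ⟨D, hne, hDn, hD⟩ := exists_dimension_family (by positivity) hs hd
  obtain ⟨x, hx⟩ := exists_adversary (n := 128 * s ^ 3) (s := s) le_rfl D R (128 * s ^ 3)
  refine ⟨cliqueInstance _ D x, isNormalized_cliqueInstance x hne hDn, ?_⟩
  set I := ∫ ω, (if Unfinished x (response (128 * s ^ 3) D (R.alg ω) x) s (128 * s ^ 3)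
    then (1 : ℝ) else 0) ∂(R.μ) with hI
  have hI1 : Integrable (fun ω => if Unfinished x (response (128 * s ^ 3) D (R.alg ω) x) s
      (128 * s ^ 3) then (1 : ℝ) else 0) R.μ :=
    R.integrable_run (cliqueInstance (128 * s ^ 3) D x)
      fun g => if Unfinished x (extendNat g) s (128 * s ^ 3) then (1 : ℝ) else 0
  have hs' : (0 : ℝ) < s := by exact_mod_cast hs
  have hhalf : I ≤ 1 / 2 := by
    have hle : ∫ ω, (numKept x (response (128 * s ^ 3) D (R.alg ω) x) s (128 * s ^ 3) : ℝ) ∂(R.μ) ≤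
        16 * s ^ 3 := by
      calc _ ≤ ∫ _ω, (16 * s ^ 3 : ℝ) ∂(R.μ) := by
            refine integral_mono (R.integrable_run (cliqueInstance (128 * s ^ 3) D x)
              fun g => (numKept x (extendNat g) s (128 * s ^ 3) : ℝ)) (integrable_const _)
              fun ω => ?_
            have h := numKept_le (x := x) (f := response (128 * s ^ 3) D (R.alg ω) x) (s := s)
              (128 * s ^ 3)
            calc _ ≤ ((2 * (8 * s ^ 2 * s) : ℕ) : ℝ) := Nat.cast_le.2 h
              _ = _ := by push_cast; ring
        _ = _ := by simp
    have h := hx.trans hle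
    push_cast at h
    have h3 : (0 : ℝ) < s ^ 3 := by positivity
    nlinarith
  calc (s : ℝ) / 2 ≤ s * (1 - I) := by nlinarith
    _ = ∫ ω, (s : ℝ) * (1 - if Unfinished x (response (128 * s ^ 3) D (R.alg ω) x) s
          (128 * s ^ 3) then (1 : ℝ) else 0) ∂(R.μ) := by
        rw [integral_const_mul, integral_sub (integrable_const _) hI1]; simp [hI]
    _ ≤ _ := by
        refine integral_mono (((integrable_const _).sub hI1).const_mul _)
          (R.integrable_run _ fun g => (makespan (cliqueInstance _ D x) g : ℝ)) fun ω => ?_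
        dsimp only
        split_ifs with h
        · simp
        · have := le_makespan_of_not_unfinished hD _ h
          rw [sub_zero, mul_one]
          exact_mod_cast this

end Adversary

/-! ### The bounds in terms of the dimension -/

theorem one_lt_log_natCast {d : ℕ} (hd : 3 ≤ d) : 1 < Real.log d := by
  rw [Real.lt_log_iff_exp_lt (by positivity)]
  have h : (3 : ℝ) ≤ d := by exact_mod_cast hd
  linarith [Real.exp_one_lt_d9]

theorem one_le_div_log {x : ℝ} (hx : 1 < x) : 1 ≤ x / Real.log x := by
  rw [one_le_div (Real.log_pos hx)]
  linarith [Real.log_le_sub_one_of_pos (zero_lt_one.trans hx)]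

/-- Some clique size `s` of order `log d / log (log d)` can be tested in `d` dimensions. -/
theorem exists_clique_size {d : ℕ} (hd : 3 ≤ d) (hL : 6 ≤ Real.log (Real.log d)) :
    ∃ s : ℕ, 0 < s ∧ (128 * s ^ 3) ^ s ≤ d ∧
      1 / 16 * (Real.log d / Real.log (Real.log d)) ≤ (s : ℝ) / 2 := by
  have hx1 := one_lt_log_natCast hd
  set x := Real.log d with hx
  set L := Real.log x with hLdef
  have hxL : 4 * L ≤ x := by
    have h := Real.quadratic_le_exp_of_nonneg (x := L) (by linarith)
    rw [hLdef, Real.exp_log (by linarith), ← hLdef] at h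
    nlinarith
  have hL0 : 0 < L := by linarith
  set y := x / (4 * L) with hy
  have hy1 : 1 ≤ y := (one_le_div (by positivity)).2 hxL
  have hyx : y * (4 * L) = x := div_mul_cancel₀ _ (by positivity)
  have hs : 0 < ⌊y⌋₊ := Nat.floor_pos.2 hy1
  have hs1 : (1 : ℝ) ≤ ⌊y⌋₊ := by exact_mod_cast hs
  have hsy : (⌊y⌋₊ : ℝ) ≤ y := Nat.floor_le (by linarith)
  have hys : y < ⌊y⌋₊ + 1 := Nat.lt_floor_add_one y
  refine ⟨⌊y⌋₊, hs, ?_, ?_⟩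
  · have hlogs : Real.log ⌊y⌋₊ ≤ L := Real.log_le_log (by linarith) (by nlinarith)
    have hlog : Real.log (((128 * ⌊y⌋₊ ^ 3) ^ ⌊y⌋₊ : ℕ) : ℝ) ≤ Real.log d := by
      push_cast
      rw [Real.log_pow, Real.log_mul (by norm_num) (by positivity), Real.log_pow,
        show (128 : ℝ) = 2 ^ 7 by norm_num, Real.log_pow, ← hx]
      push_cast
      have h2 := Real.log_two_lt_d9
      calc (⌊y⌋₊ : ℝ) * (7 * Real.log 2 + 3 * Real.log ⌊y⌋₊) ≤ ⌊y⌋₊ * (4 * L) := by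
            gcongr; linarith
        _ ≤ y * (4 * L) := by gcongr
        _ = x := hyx
    have h := (Real.log_le_log_iff (by positivity) (by positivity)).1 hlog
    exact_mod_cast h
  · have : x / L = 4 * y := by rw [hy]; field_simp
    rw [this]
    linarith

theorem one_le_expectedMakespan {d m n : ℕ} (R : RandomizedOnlineAlgorithm.{u} d m)
    (p : Fin n → Job d) (k : Fin d) (hp : ∀ g : Fin n → Fin m, 1 ≤ makespanNorm p g k) :
    1 ≤ R.expectedMakespan p := by
  have h : ∫ _ω, (1 : ℝ) ∂(R.μ) ≤ R.expectedMakespan p := by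
    refine integral_mono (integrable_const _)
      (R.integrable_run p fun g => (makespan p g : ℝ)) fun ω => ?_
    have h := (hp ((R.alg ω).run p)).trans
      (Finset.le_sup (f := fun k => makespanNorm p ((R.alg ω).run p) k) (Finset.mem_univ k))
    exact_mod_cast h
  simpa using h

theorem OnlineAlgorithm.IsCompetitive.mono {d m : ℕ} {A : OnlineAlgorithm d m} {α β : ℝ}
    (hA : A.IsCompetitive α) (h : α ≤ β) : A.IsCompetitive β := fun n p L hL k =>
  (hA n p L hL k).trans (mul_le_mul_of_nonneg_right h L.coe_nonneg)

/-- The base `exp 2 * log d` of the potential and the threshold `11 * log d / log (log d)` make the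
overload small enough for the algorithm. -/
theorem overload_condition {d : ℕ} (hd : 3 ≤ d) :
    d * d * Real.exp (Real.exp 2 * Real.log d - 1) ≤
      (Real.exp 2 * Real.log d / Real.exp 1) ^ (11 * (Real.log d / Real.log (Real.log d))) := by
  have hx1 := one_lt_log_natCast hd
  have hd' : (d : ℝ) = Real.exp (Real.log d) := (Real.exp_log (by positivity)).symm
  set x := Real.log d with hx
  have hL0 : 0 < Real.log x := Real.log_pos hx1
  have hbase : Real.exp 2 * x / Real.exp 1 = Real.exp (1 + Real.log x) := by
    rw [Real.exp_add, Real.exp_log (by linarith), show (2 : ℝ) = 1 + 1 by norm_num, Real.exp_add]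
    field_simp
  have he : Real.exp 2 ≤ 8 := by
    rw [show (2 : ℝ) = 1 + 1 by norm_num, Real.exp_add]
    nlinarith [Real.exp_one_lt_d9, Real.exp_pos 1]
  rw [hbase, hd', ← Real.exp_add, ← Real.exp_add, ← Real.exp_mul, Real.exp_le_exp]
  have h : Real.log x * (x / Real.log x) = x := mul_div_cancel₀ _ hL0.ne'
  have h' : 0 ≤ x / Real.log x := by positivity
  nlinarith

end VectorScheduling

end

theorem mainTheorem1 :
    -- the lower bound, for randomized (in particular, deterministic) online algorithms
    (∃ c : ℝ, 0 < c ∧ ∀ d : ℕ, 3 ≤ d → ∃ m n : ℕ, 0 < m ∧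
      ∀ R : VectorScheduling.RandomizedOnlineAlgorithm.{u} d m,
        ∃ p : Fin n → VectorScheduling.Job d, VectorScheduling.IsNormalized m p ∧
          c * (Real.log d / Real.log (Real.log d)) ≤ R.expectedMakespan p) ∧
    -- the matching deterministic online algorithm
    (∃ C : ℝ, 0 < C ∧
      ∃ A : ∀ d m : ℕ, 0 < m → VectorScheduling.OnlineAlgorithm d m,
        ∀ d : ℕ, 3 ≤ d → ∀ (m : ℕ) (hm : 0 < m),
          (A d m hm).IsCompetitive (C * (Real.log d / Real.log (Real.log d)))) := by
  have hδ : 0 < Real.log (Real.log 3) := by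
    have h := VectorScheduling.one_lt_log_natCast (d := 3) le_rfl
    exact Real.log_pos (by exact_mod_cast h)
  constructor
  · refine ⟨min (1 / 16) (Real.log (Real.log 3) / Real.exp 6), by positivity, fun d hd => ?_⟩
    have hx1 := VectorScheduling.one_lt_log_natCast hd
    have hL0 := Real.log_pos hx1
    by_cases hL : 6 ≤ Real.log (Real.log d)
    · obtain ⟨s, hs, hsd, hle⟩ := VectorScheduling.exists_clique_size hd hL
      refine ⟨8 * s ^ 2, 128 * s ^ 3, by positivity, fun R => ?_⟩
      obtain ⟨p, hp, h⟩ := VectorScheduling.exists_instance_half_le_expectedMakespan hs hsd R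
      refine ⟨p, hp, le_trans ?_ (hle.trans h)⟩
      gcongr
      exact min_le_left _ _
    · -- the ratio is bounded here, and a single job forces makespan `1`
      have hone : ∀ (g : Fin 1 → Fin 1) (k : Fin d),
          VectorScheduling.makespanNorm (fun _ _ => 1) g k = 1 := fun g k => by
        have hg : g 0 = 0 := Subsingleton.elim _ _
        simp [VectorScheduling.makespanNorm, VectorScheduling.load, Finset.filter_singleton, hg]
      refine ⟨1, 1, one_pos, fun R => ⟨fun _ _ => 1,
        VectorScheduling.isNormalized_of_makespanNorm (fun g k => (hone g k).ge) id
          fun k => (hone _ k).le, le_trans ?_ (VectorScheduling.one_le_expectedMakespan R _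
            ⟨0, by omega⟩ fun g => (hone g _).ge)⟩⟩
      have hx6 : Real.log d ≤ Real.exp 6 := by
        rw [← Real.log_le_iff_le_exp (by linarith)]
        linarith
      have hL3 : Real.log (Real.log 3) ≤ Real.log (Real.log d) := by
        have h3 : (3 : ℝ) ≤ d := by exact_mod_cast hd
        have h1 := VectorScheduling.one_lt_log_natCast (d := 3) le_rfl
        have h1' : (0 : ℝ) < Real.log 3 := Real.log_pos (by norm_num)
        gcongr
      calc _ ≤ Real.log (Real.log 3) / Real.exp 6 * (Real.log d / Real.log (Real.log d)) := by
            gcongr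
            exact min_le_right _ _
        _ ≤ Real.log (Real.log d) / Real.exp 6 * (Real.exp 6 / Real.log (Real.log d)) := by
            gcongr
        _ = 1 := by field_simp
  · refine ⟨52, by norm_num, fun d m hm =>
      haveI : Nonempty (Fin m) := ⟨⟨0, hm⟩⟩
      VectorScheduling.phaseAlgorithm d m (Real.exp 2 * Real.log d)
        (Real.toNNReal (11 * (Real.log d / Real.log (Real.log d)))), fun d hd m hm => ?_⟩
    have : Nonempty (Fin m) := ⟨⟨0, hm⟩⟩
    have hx1 := VectorScheduling.one_lt_log_natCast hd
    have hρ := VectorScheduling.one_le_div_log hx1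
    have hα : ((Real.toNNReal (11 * (Real.log d / Real.log (Real.log d))) : ℝ≥0) : ℝ) =
        11 * (Real.log d / Real.log (Real.log d)) := Real.coe_toNNReal _ (by linarith)
    refine (VectorScheduling.phaseAlgorithm_isCompetitive ?_ ?_).mono ?_
    · calc Real.exp 1 ≤ Real.exp 2 * 1 := by
            rw [mul_one]; exact Real.exp_le_exp.2 (by norm_num)
        _ ≤ _ := by gcongr
    · rw [hα]
      exact VectorScheduling.overload_condition hd
    · rw [hα]
      linarith
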